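/- \textbf{Definitions.} A \emph{masked unique hard-attention transformer} (UHAT) over a finite alphabet $\Sigma$ consists of a token embedding $\Sigma\to\mathbb{Q}^d$ ($d>0$), a finite sequence of layers of matching widths, an acceptance vector $t\in\mathbb{Q}^s$, and an output position (first or last). A layer is one of the following. \begin{itemize} \item A \emph{ReLU layer} replaces one fixed coordinate $x$ of every vector by $\max\{0,x\}$. \item An \emph{attention layer} of width $r>0$ is given by affine maps $A,B\colon\mathbb{Q}^r\to\mathbb{Q}^r$ and $C\colon\mathbb{Q}^{2r}\to\mathbb{Q}^{s'}$ with rational coefficients, a mask (none, $j<i$, or $j>i$) and a tie-breaking rule (leftmost or rightmost). It maps $v_1,\dots,v_n$ to $C(v_1,a_1),\dots,C(v_n,a_n)$, where $a_i=v_j$ for the leftmost (respectively rightmost) unmasked position $j$ that maximizes $\langle A(v_i),B(v_j)\rangle$, and $a_i=0$ if no position is unmasked for $i$. \end{itemize} A nonempty word is accepted if the output vector $v$ at the output position satisfies $\langle t,v\rangle>0$; the empty word is not accepted. A finite automaton is a nondeterministic finite automaton without $\varepsilon$-transitions. The size $|R|$ of a UHAT or of a finite automaton $R$ is the length of its usual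 binary encoding: for a UHAT, all rational entries of the embedding, of the layers and of the acceptance vector are written in binary; for an automaton, all states, with their status as initial or accepting, and all transitions are listed. We write $f\in 2^{2^{o(n)}}$ if $f(n)\le 2^{2^{g(n)}}$ for all $n$, for some $g$ with $g(n)=o(n)$. \textbf{Theorem.} \begin{enumerate} \item UHATs can be doubly exponentially more succinct than finite automata: for every function $f\in 2^{2^{o(n)}}$ there is a UHAT $\mathcal{T}$ such that every finite automaton $\mathcal{A}$ with $L(\mathcal{A})=L(\mathcal{T})$ has size $|\mathcal{A}|>f(|\mathcal{T}|)$. \item There are UHATs $\mathcal{T}_n$ ($n\ge 0$) of size at most $p(n)$, for some polynomial $p$, such that $L(\mathcal{T}_n)\neq\emptyset$ and every word in $L(\mathcal{T}_n)$ has length at least $2^{2^n}$, and such that for every $f\in 2^{2^{o(n)}}$ the UHAT $\mathcal{T}$ in (1) can be chosen among the $\mathcal{T}_n$. \item Every finite automaton that recognizes a non-empty language accepts a word whose length is at most its number of states. \end{enumerate} -/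

import Mathlib

open Filter Asymptotics

/-! ### Classes of representations and succinctness -/

/-- A class of finite representations of languages.  An alphabet with `k` symbols is `Fin k`. -/
structure RepresentationClass where
  /-- the representations of languages over the alphabet `Fin k` -/
  Rep : ℕ → Type
  /-- the represented language -/
  lang : ∀ {k : ℕ}, Rep k → Language (Fin k)
  /-- the length of the binary encoding -/
  size : ∀ {k : ℕ}, Rep k → ℕ

/-- `f ∈ 2^{2^{o(n)}}`. -/
def IsDoublyExpLittleO (f : ℕ → ℝ) : Prop :=
  ∃ g : ℕ → ℝ, g =o[atTop] (fun n : ℕ => (n : ℝ)) ∧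
    ∀ n, f n ≤ (2 : ℝ) ^ ((2 : ℝ) ^ g n)

/-- Every representation in `C₂` of the language of `R` has size larger than `f |R|`. -/
def ForcesBlowup {C₁ : RepresentationClass} (C₂ : RepresentationClass) (f : ℕ → ℝ) {k : ℕ}
    (R : C₁.Rep k) : Prop :=
  ∀ R₂ : C₂.Rep k, C₂.lang R₂ = C₁.lang R → f (C₁.size R) < (C₂.size R₂ : ℝ)

/-- `C₁` can be doubly exponentially more succinct than `C₂`. -/
def CanBeDoublyExpMoreSuccinct (C₁ C₂ : RepresentationClass) : Prop :=
  ∀ f : ℕ → ℝ, IsDoublyExpLittleO f →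
    ∃ (k : ℕ) (R : C₁.Rep k), ForcesBlowup C₂ f R

/-! ### Self-delimiting binary codes -/

/-- Each binary digit is preceded by the bit `true`; the bit `false` ends the code. -/
def natCode (n : ℕ) : List Bool :=
  (Nat.bits n).flatMap (fun b => [true, b]) ++ [false]

/-- Sign, numerator and denominator (in lowest terms). -/
def ratCode (q : ℚ) : List Bool :=
  decide (q < 0) :: (natCode q.num.natAbs ++ natCode q.den)

def vecCode {n : ℕ} (v : Fin n → ℚ) : List Bool :=
  (List.finRange n).flatMap fun i => ratCode (v i)

/-! ### Masked unique hard-attention transformers -/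

/-- An affine transformation `x ↦ Q x + b` from `ℚ^m` to `ℚ^n`. -/
structure RatAffine (m n : ℕ) where
  mat : Matrix (Fin n) (Fin m) ℚ
  vec : Fin n → ℚ

def RatAffine.apply {m n : ℕ} (T : RatAffine m n) (x : Fin m → ℚ) : Fin n → ℚ :=
  T.mat.mulVec x + T.vec

def RatAffine.code {m n : ℕ} (T : RatAffine m n) : List Bool :=
  ((List.finRange n).flatMap fun i => vecCode (T.mat i)) ++ vecCode T.vec

/-- No masking, strict future masking (`j < i`), strict past masking (`j > i`). -/
inductive Mask
  | none
  | strictFuture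
  | strictPast

def Mask.allows {n : ℕ} : Mask → Fin n → Fin n → Prop
  | .none, _, _ => True
  | .strictFuture, i, j => j < i
  | .strictPast, i, j => i < j

def Mask.code : Mask → List Bool
  | .none => [false, false]
  | .strictFuture => [true, false]
  | .strictPast => [false, true]

inductive TieBreak
  | leftmost
  | rightmost

def TieBreak.select {n : ℕ} : TieBreak → (B : Finset (Fin n)) → B.Nonempty → Fin n
  | .leftmost, B, h => B.min' h
  | .rightmost, B, h => B.max' h

def TieBreak.code : TieBreak → List Bool
  | .leftmost => [false]
  | .rightmost => [true]

/-- A unique hard-attention layer of width `r > 0` with outputs in `ℚ^s`. -/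
structure AttentionLayer (r s : ℕ) where
  width_pos : 0 < r
  A : RatAffine r r
  B : RatAffine r r
  C : RatAffine (r + r) s
  mask : Mask
  tie : TieBreak

namespace AttentionLayer

variable {r s n : ℕ} (ℓ : AttentionLayer r s) (v : Fin n → Fin r → ℚ)

/-- The score of position `j` as seen from position `i`. -/
def score (i j : Fin n) : ℚ :=
  dotProduct (ℓ.A.apply (v i)) (ℓ.B.apply (v j))

open Classical in
/-- The set `U_i` of unmasked positions. -/
noncomputable def unmasked (i : Fin n) : Finset (Fin n) :=
  Finset.univ.filter fun j => ℓ.mask.allows i j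

open Classical in
/-- The set `B_i` of unmasked positions of maximal score. -/
noncomputable def best (i : Fin n) : Finset (Fin n) :=
  (ℓ.unmasked i).filter fun j => ∀ j' ∈ ℓ.unmasked i, ℓ.score v i j' ≤ ℓ.score v i j

theorem best_nonempty (i : Fin n) (h : (ℓ.unmasked i).Nonempty) : (ℓ.best v i).Nonempty := by
  obtain ⟨j, hj, hmax⟩ := Finset.exists_max_image (ℓ.unmasked i) (ℓ.score v i) h
  exact ⟨j, Finset.mem_filter.2 ⟨hj, hmax⟩⟩

open Classical in
/-- The attention vector at position `i`. -/
noncomputable def attentionVector (i : Fin n) : Fin r → ℚ :=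
  if h : (ℓ.unmasked i).Nonempty then v (ℓ.tie.select (ℓ.best v i) (ℓ.best_nonempty v i h))
  else 0

/-- The output sequence `C(v_1, a_1), …, C(v_n, a_n)`. -/
noncomputable def eval (i : Fin n) : Fin s → ℚ :=
  ℓ.C.apply (Fin.append (v i) (ℓ.attentionVector v i))

def code : List Bool :=
  natCode s ++ ℓ.mask.code ++ ℓ.tie.code ++ ℓ.A.code ++ ℓ.B.code ++ ℓ.C.code

end AttentionLayer

/-- The ReLU layer acting on coordinate `k`. -/
def reluLayer {r n : ℕ} (k : Fin r) (v : Fin n → Fin r → ℚ) (i : Fin n) : Fin r → ℚ :=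
  Function.update (v i) k (max 0 (v i k))

/-- Sequences of attention layers and ReLU layers of matching widths, with inputs in `ℚ^r` and
outputs in `ℚ^t`.  The first layer of `attention ℓ L` and of `relu k L` is applied first. -/
inductive LayerSeq : ℕ → ℕ → Type
  | nil (r : ℕ) : LayerSeq r r
  | attention {r s t : ℕ} (ℓ : AttentionLayer r s) (L : LayerSeq s t) : LayerSeq r t
  | relu {r t : ℕ} (k : Fin r) (L : LayerSeq r t) : LayerSeq r t

noncomputable def LayerSeq.eval {n : ℕ} :
    {r t : ℕ} → LayerSeq r t → (Fin n → Fin r → ℚ) → (Fin n → Fin t → ℚ)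
  | _, _, .nil _, v => v
  | _, _, .attention ℓ L, v => L.eval (ℓ.eval v)
  | _, _, .relu k L, v => L.eval (reluLayer k v)

def LayerSeq.code : {r t : ℕ} → LayerSeq r t → List Bool
  | _, _, .nil _ => [false, false]
  | _, _, .attention ℓ L => [true, false] ++ ℓ.code ++ L.code
  | _, _, .relu k L => [false, true] ++ natCode k ++ L.code

inductive OutputPosition
  | first
  | last

def OutputPosition.index : OutputPosition → (n : ℕ) → 0 < n → Fin n
  | .first, _, h => ⟨0, h⟩
  | .last, n, h => ⟨n - 1, Nat.sub_lt h Nat.one_pos⟩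

def OutputPosition.code : OutputPosition → List Bool
  | .first => [false]
  | .last => [true]

/-- A masked unique hard-attention transformer over the alphabet `Fin k`, given together with an
acceptance vector and an output position. -/
structure UHAT (k : ℕ) where
  /-- dimension of the token embedding -/
  d : ℕ
  d_pos : 0 < d
  emb : Fin k → Fin d → ℚ
  /-- dimension of the output vectors -/
  s : ℕ
  layers : LayerSeq d s
  acceptVec : Fin s → ℚ
  output : OutputPosition

namespace UHAT

variable {k : ℕ} (T : UHAT k)

/-- The output sequence of the transformer on a word. -/
noncomputable def run (w : List (Fin k)) : Fin w.length → Fin T.s → ℚ :=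
  T.layers.eval fun i => T.emb (w.get i)

/-- The recognized language (the empty word has no output position and is not accepted). -/
def lang : Language (Fin k) :=
  {w | ∃ h : 0 < w.length,
    0 < dotProduct T.acceptVec (T.run w (T.output.index w.length h))}

/-- The binary encoding: alphabet size, embedding, layers, acceptance vector, output position. -/
def code : List Bool :=
  natCode k ++ natCode T.d ++ ((List.finRange k).flatMap fun a => vecCode (T.emb a)) ++
    T.layers.code ++ vecCode T.acceptVec ++ T.output.code

def size : ℕ := T.code.length

end UHAT

/-- The class of masked unique hard-attention transformers. -/
def uhatClass : RepresentationClass where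
  Rep := UHAT
  lang := UHAT.lang
  size := UHAT.size

/-! ### Finite automata -/

/-- A (nondeterministic) finite automaton over the alphabet `Fin k`; its states are the elements
of `Fin numStates`. -/
structure FiniteAutomaton (k : ℕ) where
  numStates : ℕ
  nfa : NFA (Fin k) (Fin numStates)

namespace FiniteAutomaton

variable {k : ℕ} (A : FiniteAutomaton k)

def lang : Language (Fin k) := A.nfa.accepts

open Classical in
/-- The binary encoding: alphabet size, number of states, for each state two bits that tell
whether it is initial and whether it is accepting, and the list of all transitions `(q, a, q')`. -/
noncomputable def code : List Bool :=
  natCode k ++ natCode A.numStates ++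
    ((List.finRange A.numStates).flatMap fun q =>
      [decide (q ∈ A.nfa.start), decide (q ∈ A.nfa.accept)]) ++
    ((List.finRange A.numStates).flatMap fun q =>
      (List.finRange k).flatMap fun a =>
        (List.finRange A.numStates).flatMap fun q' =>
          if q' ∈ A.nfa.step q a then [true] ++ natCode q ++ natCode a ++ natCode q' else []) ++
    [false]

noncomputable def size : ℕ := A.code.length

end FiniteAutomaton

/-- The class of finite automata. -/
noncomputable def finiteAutomatonClass : RepresentationClass where
  Rep := FiniteAutomaton
  lang := FiniteAutomaton.lang
  size := FiniteAutomaton.size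

/-!
Words over `Fin 4` consist of the digits `0`, `1` and the markers `2`, `3`; the level of a position
is the number written by the `t` tokens before it. If every marker of level `c + 1` is preceded by
its own `3` of level `c`, and every `3` by its own `2` of the same level, then each level has at
least twice as many markers as the next, so that a marker of the top level `2 ^ t - 1` forces length
at least `2 ^ (2 ^ t - 1)`. The ternary ruler sequence, with levels written out, shows that such
words exist.

A transformer of size linear in `t` checks these conditions. Attention to the previous position
passes from `t`-digit to `t + 1`-digit levels and their squares, ReLU supplying the products of
digits and levels. The predecessor of a marker is found by hard attention, because
`(2 * c - δ) * l - l ^ 2` is, for `δ ≤ 1`, maximal over the integers exactly at `l = c` and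
`l = c - δ`. An automaton, in contrast, accepts a word shorter than its number of states, as a path
without repeated states suffices.
-/

section Automata

variable {α σ : Type*}

theorem append_mem_accepts_iff (M : NFA α σ) (x y : List α) :
    x ++ y ∈ M.accepts ↔ ∃ q ∈ M.evalFrom M.start x, y ∈ M.acceptsFrom {q} := by
  simp only [NFA.mem_accepts, NFA.mem_acceptsFrom, NFA.evalFrom_append]
  constructor
  · rintro ⟨f, hf, h⟩
    obtain ⟨q, hq, hqf⟩ := NFA.mem_evalFrom_iff_exists.1 h
    exact ⟨q, hq, f, hf, hqf⟩
  · rintro ⟨q, hq, f, hf, hqf⟩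
    exact ⟨f, hf, NFA.mem_evalFrom_iff_exists.2 ⟨q, hq, hqf⟩⟩

theorem exists_mem_accepts_length_lt_card [Fintype σ] (M : NFA α σ) (h : ∃ w, w ∈ M.accepts) :
    ∃ w ∈ M.accepts, w.length < Fintype.card σ := by
  classical
  obtain ⟨w, hw, hmin⟩ := exists_minimalFor_of_wellFoundedLT (· ∈ M.accepts) List.length h
  refine ⟨w, hw, ?_⟩
  by_contra! hcard
  have hsplit (m : Fin (w.length + 1)) :
      ∃ q ∈ M.evalFrom M.start (w.take m), w.drop m ∈ M.acceptsFrom {q} := by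
    rwa [← append_mem_accepts_iff, List.take_append_drop]
  choose q hq hacc using hsplit
  obtain ⟨i, j, hij, hqij⟩ : ∃ i j, i < j ∧ q i = q j := by
    obtain ⟨i, j, hne, heq⟩ := Fintype.exists_ne_map_eq_of_card_lt q (by simpa using by omega)
    rcases hne.lt_or_gt with hlt | hlt
    exacts [⟨i, j, hlt, heq⟩, ⟨j, i, hlt, heq.symm⟩]
  have hpumped : w.take i ++ w.drop j ∈ M.accepts :=
    (append_mem_accepts_iff M _ _).2 ⟨q i, hq i, hqij ▸ hacc j⟩
  have := hmin hpumped
  simp only [List.length_append, List.length_take, List.length_drop] at this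
  omega

namespace FiniteAutomaton

variable {k : ℕ} (A : FiniteAutomaton k)

theorem exists_mem_lang_length_lt (h : ∃ w, w ∈ A.lang) :
    ∃ w ∈ A.lang, w.length < A.numStates := by
  simpa [lang] using exists_mem_accepts_length_lt_card A.nfa h

theorem numStates_lt_size : A.numStates < A.size := by
  simp only [size, code, List.length_append, List.length_flatMap, List.length_cons,
    List.length_nil, List.map_const', List.sum_replicate, List.length_finRange, smul_eq_mul]
  omega

end FiniteAutomaton

end Automata

theorem eventually_forcesBlowup {C₁ C₂ : RepresentationClass} {k : ℕ → ℕ}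
    {T : ∀ n, C₁.Rep (k n)}
    (hshort : ∀ {k : ℕ} (R : C₂.Rep k), (∃ w, w ∈ C₂.lang R) →
      ∃ w ∈ C₂.lang R, w.length < C₂.size R)
    (hne : ∀ n, ∃ w, w ∈ C₁.lang (T n)) (hlong : ∀ n, ∀ w ∈ C₁.lang (T n), 2 ^ 2 ^ n ≤ w.length)
    (htop : Tendsto (fun n => C₁.size (T n)) atTop atTop)
    (hlinear : (fun n => (C₁.size (T n) : ℝ)) =O[atTop] fun n => (n : ℝ))
    {f : ℕ → ℝ} (hf : IsDoublyExpLittleO f) :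
    ∀ᶠ n in atTop, ForcesBlowup C₂ f (T n) := by
  obtain ⟨g, hg, hfg⟩ := hf
  have hgo : (fun n => g (C₁.size (T n))) =o[atTop] fun n => (n : ℝ) :=
    (hg.comp_tendsto htop).trans_isBigO hlinear
  filter_upwards [hgo.bound one_pos] with n hgn R hR
  have hgn' : g (C₁.size (T n)) ≤ n := by
    simpa using (le_abs_self _).trans hgn
  obtain ⟨w, hw, hlt⟩ := hshort R (hR ▸ hne n)
  have hlow : 2 ^ 2 ^ n < C₂.size R := (hlong n w (hR ▸ hw)).trans_lt hlt
  calc f (C₁.size (T n)) ≤ (2 : ℝ) ^ (2 : ℝ) ^ g (C₁.size (T n)) := hfg _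
    _ ≤ (2 : ℝ) ^ (2 : ℝ) ^ (n : ℝ) := by gcongr <;> norm_num
    _ = (2 ^ 2 ^ n : ℕ) := by exact_mod_cast Real.rpow_natCast 2 (2 ^ n)
    _ < C₂.size R := by exact_mod_cast hlow

section LayeredWords

/-- The tokens of `Fin 4` that mark a position; the others, `0` and `1`, are binary digits. -/
def markers : Finset (Fin 4) := {2, 3}

theorem mem_markers {a : Fin 4} : a ∈ markers ↔ a = 2 ∨ a = 3 := by
  simp [markers]

/-- The level of position `i` in the word `x`: the number whose binary digits, most significant
first, are the `t` tokens before `i`. Markers and missing tokens count as digits `0`. -/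
def level (x : ℕ → Fin 4) : ℕ → ℕ → ℕ
  | t + 1, i + 1 => (if x i = 1 then 1 else 0) + 2 * level x t i
  | _, _ => 0

/-- The last marker before `i` whose level is that of `i` or the one `δ` below is a `τ` that lies
`δ` below `i`. -/
def Follows (x : ℕ → Fin 4) (t δ : ℕ) (τ : Fin 4) (i : ℕ) : Prop :=
  ∃ j, IsGreatest {k | k < i ∧ x k ∈ markers ∧
    (level x t k = level x t i ∨ level x t k + δ = level x t i)} j ∧
    x j = τ ∧ level x t j + δ = level x t i

/-- Every marker of level `c + 1` has its own `3` of level `c` and every `3` its own `2` of the same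
level; the last token is a marker of the top level `2 ^ t - 1`. A word of length `n` is given by a
sequence of which the first `n` terms matter. -/
structure IsLayered (x : ℕ → Fin 4) (t n : ℕ) : Prop where
  follows_three : ∀ i < n, x i ∈ markers → level x t i ≠ 0 → Follows x t 1 3 i
  follows_two : ∀ i < n, x i = 3 → Follows x t 0 2 i
  exists_last : ∃ i, i + 1 = n ∧ x i ∈ markers ∧ level x t i + 1 = 2 ^ t

/-- The positions before `n` of level `c` that carry a token of `A`. -/
def levelSet (x : ℕ → Fin 4) (t n : ℕ) (A : Finset (Fin 4)) (c : ℕ) : Finset ℕ :=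
  {i ∈ Finset.range n | x i ∈ A ∧ level x t i = c}

variable {x : ℕ → Fin 4} {t n c δ i : ℕ} {τ : Fin 4} {A : Finset (Fin 4)}

theorem level_lt (x : ℕ → Fin 4) : ∀ t i, level x t i < 2 ^ t
  | 0, _ => by simp [level]
  | t + 1, 0 => by simp [level]
  | t + 1, i + 1 => by
    have := level_lt x t i
    simp only [level, pow_succ]
    split_ifs <;> omega

theorem mem_levelSet :
    i ∈ levelSet x t n A c ↔ i < n ∧ x i ∈ A ∧ level x t i = c := by
  simp [levelSet]

theorem card_levelSet_add_le (hA : A ⊆ markers)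
    (h : ∀ i ∈ levelSet x t n A (c + δ), Follows x t δ τ i) :
    (levelSet x t n A (c + δ)).card ≤ (levelSet x t n {τ} c).card := by
  choose! j hj hτ hlevel using h
  refine Finset.card_le_card_of_injOn j (fun i hi => ?_) fun i hi i' hi' hjj => ?_
  · obtain ⟨hin, -, hic⟩ := mem_levelSet.1 hi
    have := hlevel i hi
    exact mem_levelSet.2
      ⟨(hj i hi).1.1.trans hin, Finset.mem_singleton.2 (hτ i hi), by omega⟩
  · by_contra hne
    wlog hlt : i < i' generalizing i i'
    · exact this i' hi' i hi hjj.symm (Ne.symm hne) (by omega)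
    obtain ⟨-, hiA, hic⟩ := mem_levelSet.1 hi
    obtain ⟨-, -, hic'⟩ := mem_levelSet.1 hi'
    -- `i` is itself a marker of the level of `i'`, so it is not after the marker `i'` follows.
    have hle : i ≤ j i' := (hj i' hi').2 ⟨hlt, hA hiA, .inl (hic.trans hic'.symm)⟩
    have := (hj i hi).1.1
    omega

theorem card_levelSet_markers :
    (levelSet x t n markers c).card
      = (levelSet x t n {2} c).card + (levelSet x t n {3} c).card := by
  rw [← Finset.card_union_of_disjoint]
  · congr 1
    ext i
    simp only [Finset.mem_union, mem_levelSet, mem_markers, Finset.mem_singleton]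
    tauto
  · refine Finset.disjoint_left.2 fun i h2 h3 => ?_
    simp_all [mem_levelSet]

namespace IsLayered

theorem two_mul_card_levelSet_succ_le (h : IsLayered x t n) (c : ℕ) :
    2 * (levelSet x t n markers (c + 1)).card ≤ (levelSet x t n markers c).card := by
  have hlower : (levelSet x t n markers (c + 1)).card ≤ (levelSet x t n {3} c).card := by
    refine card_levelSet_add_le subset_rfl fun i hi => ?_
    obtain ⟨hin, hmarker, hic⟩ := mem_levelSet.1 hi
    exact h.follows_three i hin hmarker (by omega)
  have hequal : (levelSet x t n {3} c).card ≤ (levelSet x t n {2} c).card := by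
    refine card_levelSet_add_le (δ := 0) (by decide) fun i hi => ?_
    obtain ⟨hin, hthree, -⟩ := mem_levelSet.1 hi
    exact h.follows_two i hin (Finset.mem_singleton.1 hthree)
  rw [card_levelSet_markers (c := c)]
  omega

theorem two_pow_mul_card_levelSet_le (h : IsLayered x t n) (c : ℕ) :
    2 ^ c * (levelSet x t n markers c).card ≤ n := by
  induction c with
  | zero => simpa [levelSet] using Finset.card_filter_le (Finset.range n) _
  | succ c ih =>
    calc 2 ^ (c + 1) * (levelSet x t n markers (c + 1)).card
        = 2 ^ c * (2 * (levelSet x t n markers (c + 1)).card) := by ring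
      _ ≤ 2 ^ c * (levelSet x t n markers c).card := by
        gcongr
        exact h.two_mul_card_levelSet_succ_le c
      _ ≤ n := ih

theorem two_pow_le (h : IsLayered x t n) : 2 ^ (2 ^ t - 1) ≤ n := by
  obtain ⟨i, hin, hi, hlevel⟩ := h.exists_last
  have hpos : 0 < (levelSet x t n markers (2 ^ t - 1)).card :=
    Finset.card_pos.2 ⟨i, mem_levelSet.2 ⟨by omega, hi, by omega⟩⟩
  exact (Nat.le_mul_of_pos_right _ hpos).trans (h.two_pow_mul_card_levelSet_le _)

end IsLayered

end LayeredWords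

section Ruler

/-- The word made of blocks of length `t + 1`, the block `q` consisting of the `t` binary digits of
`lev q`, most significant first, and the marker `mark q`. -/
def blockWord (t : ℕ) (lev : ℕ → ℕ) (mark : ℕ → Fin 4) (p : ℕ) : Fin 4 :=
  if p % (t + 1) = t then mark (p / (t + 1))
  else if (lev (p / (t + 1))).testBit (t - 1 - p % (t + 1)) then 1 else 0

variable {t : ℕ} {lev : ℕ → ℕ} {mark : ℕ → Fin 4}

theorem blockWord_add {r : ℕ} (hr : r ≤ t) (q : ℕ) :
    blockWord t lev mark ((t + 1) * q + r)
      = if r = t then mark q else if (lev q).testBit (t - 1 - r) then 1 else 0 := by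
  have hmod : ((t + 1) * q + r) % (t + 1) = r := by
    rw [Nat.mul_add_mod, Nat.mod_eq_of_lt (by omega)]
  have hdiv : ((t + 1) * q + r) / (t + 1) = q := by
    rw [Nat.mul_add_div (by omega), Nat.div_eq_of_lt (by omega), add_zero]
  rw [blockWord, hmod, hdiv]

theorem blockWord_marker (q : ℕ) : blockWord t lev mark ((t + 1) * q + t) = mark q := by
  simp [blockWord_add le_rfl]

theorem exists_of_blockWord_mem_markers {p : ℕ} (h : blockWord t lev mark p ∈ markers) :
    ∃ q, p = (t + 1) * q + t := by
  refine ⟨p / (t + 1), ?_⟩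
  by_contra hp
  have hmod : p % (t + 1) ≠ t := fun hmod => hp <| by
    simpa only [hmod] using (Nat.div_add_mod p (t + 1)).symm
  rw [blockWord, if_neg hmod] at h
  split_ifs at h <;> simp [markers] at h

theorem level_blockWord_add {q : ℕ} (hq : lev q < 2 ^ t) {u : ℕ} (hu : u ≤ t) :
    level (blockWord t lev mark) u ((t + 1) * q + u) = lev q / 2 ^ (t - u) := by
  induction u with
  | zero => simp [level, Nat.div_eq_of_lt hq]
  | succ u ih =>
    have hdigit : blockWord t lev mark ((t + 1) * q + u)
        = if (lev q).testBit (t - (u + 1)) then 1 else 0 := by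
      rw [blockWord_add (by omega), if_neg (by omega), show t - (u + 1) = t - 1 - u by omega]
    have hdiv : lev q / 2 ^ (t - u) = lev q / 2 ^ (t - (u + 1)) / 2 := by
      rw [Nat.div_div_eq_div_mul, ← pow_succ, show t - (u + 1) + 1 = t - u by omega]
    rw [← add_assoc, level, ih (by omega), hdigit, hdiv, Nat.testBit_eq_decide_div_mod_eq]
    rcases Nat.mod_two_eq_zero_or_one (lev q / 2 ^ (t - (u + 1))) with h | h <;>
      simp [h] <;> omega

theorem level_blockWord {q : ℕ} (hq : lev q < 2 ^ t) :
    level (blockWord t lev mark) t ((t + 1) * q + t) = lev q := by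
  simpa using level_blockWord_add hq le_rfl

theorem follows_blockWord {m j δ : ℕ} {τ : Fin 4} (hmark : ∀ q, mark q ∈ markers)
    (hlev : ∀ q ≤ m, lev q < 2 ^ t)
    (hj : IsGreatest {k | k < m ∧ (lev k = lev m ∨ lev k + δ = lev m)} j) (hτ : mark j = τ)
    (hδ : lev j + δ = lev m) :
    Follows (blockWord t lev mark) t δ τ ((t + 1) * m + t) := by
  obtain ⟨⟨hjm, -⟩, hlast⟩ := hj
  refine ⟨(t + 1) * j + t, ⟨⟨by gcongr, ?_, .inr ?_⟩, ?_⟩, ?_, ?_⟩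
  · exact (blockWord_marker j).symm ▸ hmark j
  · rw [level_blockWord (hlev j hjm.le), level_blockWord (hlev m le_rfl), hδ]
  · rintro k ⟨hkm, hk, hklev⟩
    obtain ⟨q, rfl⟩ := exists_of_blockWord_mem_markers hk
    have hqm : q < m := by
      by_contra! hmq
      have := Nat.mul_le_mul_left (t + 1) hmq
      omega
    rw [level_blockWord (hlev q hqm.le), level_blockWord (hlev m le_rfl)] at hklev
    gcongr
    exact hlast ⟨hqm, hklev⟩
  · exact (blockWord_marker j).trans hτ
  · rw [level_blockWord (hlev j hjm.le), level_blockWord (hlev m le_rfl), hδ]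

/-- The markers of the ternary ruler, whose tick `m = 3 ^ e * b` with `3 ∤ b` has level `e`. The
multiples of `3 ^ e` between two consecutive ticks of level above `e` are one `2` and then one `3`
of level `e`. -/
def rulerMark (m : ℕ) : Fin 4 :=
  if m / 3 ^ padicValNat 3 m % 3 = 2 then 3 else 2

theorem rulerMark_mem_markers (m : ℕ) : rulerMark m ∈ markers := by
  unfold rulerMark
  split_ifs <;> decide

theorem padicValNat_pow_mul_of_not_dvd {p : ℕ} [Fact p.Prime] {e b : ℕ} (hb : ¬ p ∣ b) :
    padicValNat p (p ^ e * b) = e := by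
  have hb0 : b ≠ 0 := by rintro rfl; exact hb (dvd_zero p)
  rw [padicValNat.mul (pow_ne_zero _ (Nat.Prime.ne_zero Fact.out)) hb0, padicValNat.prime_pow,
    padicValNat.eq_zero_of_not_dvd hb, add_zero]

theorem rulerMark_pow_mul {e b : ℕ} (hb : ¬ 3 ∣ b) :
    rulerMark (3 ^ e * b) = if b % 3 = 2 then 3 else 2 := by
  rw [rulerMark, padicValNat_pow_mul_of_not_dvd hb, Nat.mul_div_cancel_left _ (by positivity)]

theorem isGreatest_padicValNat {p : ℕ} [Fact p.Prime] {e b δ : ℕ} (hb : ¬ p ∣ b)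
    (hδ : e + δ = padicValNat p (p ^ e * (b + 1))) :
    IsGreatest {k | k < p ^ e * (b + 1) ∧ (padicValNat p k = padicValNat p (p ^ e * (b + 1)) ∨
      padicValNat p k + δ = padicValNat p (p ^ e * (b + 1)))} (p ^ e * b) := by
  have hpe : 0 < p ^ e := pow_pos (Nat.Prime.pos Fact.out) e
  refine ⟨⟨by gcongr; omega, .inr (by rw [padicValNat_pow_mul_of_not_dvd hb, hδ])⟩, ?_⟩
  rintro k ⟨hlt, hk⟩
  obtain ⟨c, rfl⟩ : p ^ e ∣ k := (pow_dvd_pow p (by omega)).trans pow_padicValNat_dvd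
  have : c < b + 1 := Nat.lt_of_mul_lt_mul_left hlt
  gcongr
  omega

/-- The blocks `0, …, 3 ^ N` of this word, `N = 2 ^ t - 1`, form a layered word. -/
def rulerWord (t : ℕ) : ℕ → Fin 4 :=
  blockWord t (padicValNat 3) rulerMark

theorem padicValNat_lt_two_pow {q : ℕ} (hq : q ≤ 3 ^ (2 ^ t - 1)) : padicValNat 3 q < 2 ^ t := by
  have hlog := (padicValNat_le_nat_log (p := 3) q).trans (Nat.log_mono_right hq)
  rw [Nat.log_pow (by norm_num)] at hlog
  have := Nat.two_pow_pos t
  omega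

theorem follows_rulerWord {e b δ : ℕ} (hb : ¬ 3 ∣ b)
    (hle : 3 ^ e * (b + 1) ≤ 3 ^ (2 ^ t - 1))
    (hδ : e + δ = padicValNat 3 (3 ^ e * (b + 1))) :
    Follows (rulerWord t) t δ (if b % 3 = 2 then 3 else 2)
      ((t + 1) * (3 ^ e * (b + 1)) + t) :=
  follows_blockWord rulerMark_mem_markers (fun _ hq => padicValNat_lt_two_pow (hq.trans hle))
    (isGreatest_padicValNat hb hδ) (rulerMark_pow_mul hb)
    (by rw [padicValNat_pow_mul_of_not_dvd hb, hδ])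

theorem follows_three_rulerWord {q : ℕ} (hq : q ≤ 3 ^ (2 ^ t - 1)) (hne : padicValNat 3 q ≠ 0) :
    Follows (rulerWord t) t 1 3 ((t + 1) * q + t) := by
  have hq0 : q ≠ 0 := by rintro rfl; simp at hne
  obtain ⟨e, b, hb, rfl⟩ := Nat.exists_eq_pow_mul_and_not_dvd hq0 3 (by norm_num)
  have hval := padicValNat_pow_mul_of_not_dvd (e := e) hb
  obtain ⟨e, rfl⟩ := Nat.exists_eq_add_one_of_ne_zero (hval ▸ hne)
  obtain ⟨a, rfl⟩ := Nat.exists_eq_add_one_of_ne_zero (n := b) (by rintro rfl; simp at hb)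
  have hprev : 3 ^ (e + 1) * (a + 1) = 3 ^ e * (3 * a + 2 + 1) := by ring
  rw [hprev] at hq hval ⊢
  simpa using follows_rulerWord (b := 3 * a + 2) (by omega) hq hval.symm

theorem follows_two_rulerWord {q : ℕ} (hq : q ≤ 3 ^ (2 ^ t - 1)) (hmark : rulerMark q = 3) :
    Follows (rulerWord t) t 0 2 ((t + 1) * q + t) := by
  have hq0 : q ≠ 0 := by rintro rfl; simp [rulerMark] at hmark
  obtain ⟨e, b, hb, rfl⟩ := Nat.exists_eq_pow_mul_and_not_dvd hq0 3 (by norm_num)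
  have hb2 : b % 3 = 2 := by
    by_contra h
    simp [rulerMark_pow_mul hb, h] at hmark
  obtain ⟨a, rfl⟩ := Nat.exists_eq_add_one_of_ne_zero (n := b) (by rintro rfl; simp at hb2)
  have := follows_rulerWord (b := a) (δ := 0) (by omega) hq
    (padicValNat_pow_mul_of_not_dvd hb).symm
  rwa [if_neg (by omega)] at this

theorem isLayered_rulerWord (t : ℕ) :
    IsLayered (rulerWord t) t ((t + 1) * (3 ^ (2 ^ t - 1) + 1)) := by
  have hblock {q : ℕ} (hq : (t + 1) * q + t < (t + 1) * (3 ^ (2 ^ t - 1) + 1)) :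
      q ≤ 3 ^ (2 ^ t - 1) :=
    Nat.lt_succ_iff.1 (Nat.lt_of_mul_lt_mul_left (Nat.lt_of_add_right_lt hq))
  refine ⟨fun i hi hmi hne => ?_, fun i hi hmi => ?_, (t + 1) * 3 ^ (2 ^ t - 1) + t, by ring,
    ?_, ?_⟩
  · obtain ⟨q, rfl⟩ := exists_of_blockWord_mem_markers hmi
    rw [rulerWord, level_blockWord (padicValNat_lt_two_pow (hblock hi))] at hne
    exact follows_three_rulerWord (hblock hi) hne
  · obtain ⟨q, rfl⟩ := exists_of_blockWord_mem_markers (mem_markers.2 (.inr hmi))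
    rw [rulerWord, blockWord_marker] at hmi
    exact follows_two_rulerWord (hblock hi) hmi
  · rw [rulerWord, blockWord_marker]
    exact rulerMark_mem_markers _
  · have := Nat.two_pow_pos t
    rw [rulerWord, level_blockWord (padicValNat_lt_two_pow le_rfl), padicValNat.prime_pow]
    omega

end Ruler

namespace AttentionLayer

variable {r s n : ℕ} {ℓ : AttentionLayer r s} {v : Fin n → Fin r → ℚ} {i j : Fin n}

theorem mem_unmasked : j ∈ ℓ.unmasked i ↔ ℓ.mask.allows i j := by
  simp [unmasked]

theorem attentionVector_eq_zero (h : ℓ.unmasked i = ∅) : ℓ.attentionVector v i = 0 := by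
  simp [attentionVector, h]

theorem exists_attentionVector_eq (h : (ℓ.unmasked i).Nonempty) :
    ∃ j ∈ ℓ.best v i, ℓ.attentionVector v i = v j := by
  rw [attentionVector, dif_pos h]
  refine ⟨_, ?_, rfl⟩
  cases ℓ.tie
  exacts [Finset.min'_mem _ _, Finset.max'_mem _ _]

theorem attentionVector_eq_of_isGreatest (htie : ℓ.tie = .rightmost)
    (hj : IsGreatest (ℓ.best v i : Set (Fin n)) j) : ℓ.attentionVector v i = v j := by
  have h : (ℓ.unmasked i).Nonempty := ⟨j, (Finset.mem_filter.1 hj.1).1⟩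
  rw [attentionVector, dif_pos h, htie]
  exact congrArg v ((Finset.isGreatest_max' _ _).unique hj)

theorem mem_best_iff_of_score_le {P : Fin n → Prop} {top : ℚ}
    (hle : ∀ k ∈ ℓ.unmasked i, ℓ.score v i k ≤ top)
    (htop : ∀ k ∈ ℓ.unmasked i, ℓ.score v i k = top ↔ P k)
    (hex : ∃ k ∈ ℓ.unmasked i, P k) : j ∈ ℓ.best v i ↔ j ∈ ℓ.unmasked i ∧ P j := by
  obtain ⟨k, hk, hPk⟩ := hex
  rw [best, Finset.mem_filter]
  refine and_congr_right fun hj => ⟨fun h => (htop j hj).1 ?_, fun hPj k' hk' => ?_⟩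
  · exact (hle j hj).antisymm ((htop k hk).2 hPk ▸ h k hk)
  · exact (htop j hj).2 hPj ▸ hle k' hk'

theorem exists_isGreatest_best (h : (ℓ.unmasked i).Nonempty) :
    ∃ j, IsGreatest (ℓ.best v i : Set (Fin n)) j :=
  ⟨_, Finset.isGreatest_max' _ (ℓ.best_nonempty v i h)⟩

end AttentionLayer

/-- Affine forms in `m` variables; layers are specified by lists of such forms. -/
abbrev AffineForm (m : ℕ) : Type := (Fin m → ℚ) →ᵃ[ℚ] ℚ

/-- The affine transformation whose components are the forms `φ i`. -/
noncomputable def RatAffine.ofForms {m n : ℕ} (φ : Fin n → AffineForm m) : RatAffine m n where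
  mat := LinearMap.toMatrix' (LinearMap.pi fun i => (φ i).linear)
  vec i := φ i 0

theorem RatAffine.ofForms_apply {m n : ℕ} (φ : Fin n → AffineForm m) (x : Fin m → ℚ) :
    (ofForms φ).apply x = fun i => φ i x := by
  funext i
  have h := congrFun (AffineMap.decomp (φ i)) x
  simpa [apply, ofForms, LinearMap.toMatrix'_mulVec] using h.symm

namespace AffineForm

variable {m : ℕ}

/-- The form that reads register `k`. -/
def reg (k : Fin m) : AffineForm m := (LinearMap.proj k).toAffineMap

/-- The form that reads register `k` of a position, given the registers of the position followed by
those of the position it attends to. -/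
def own (k : Fin m) : AffineForm (m + m) := reg (Fin.castAdd m k)

/-- The form that reads register `k` of the attended position, given the registers of a position
followed by those of the position it attends to. -/
def att (k : Fin m) : AffineForm (m + m) := reg (Fin.natAdd m k)

/-- The constant form. -/
def const (c : ℚ) : AffineForm m := AffineMap.const ℚ _ c

@[simp] theorem reg_apply (k : Fin m) (x : Fin m → ℚ) : reg k x = x k := rfl

@[simp] theorem own_apply (k : Fin m) (x y : Fin m → ℚ) : own k (Fin.append x y) = x k :=
  Fin.append_left x y k

@[simp] theorem att_apply (k : Fin m) (x y : Fin m → ℚ) : att k (Fin.append x y) = y k :=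
  Fin.append_right x y k

@[simp] theorem const_apply (c : ℚ) (x : Fin m → ℚ) : const c x = c := rfl

end AffineForm

namespace AttentionLayer

open AffineForm

variable {r s n : ℕ} [r.AtLeastTwo]

/-- The attention layer in which position `i` gives `base + query i * key` as score to a position
with values `base` and `key`, breaks ties to the right and outputs the forms `out`. -/
noncomputable def ofForms (base query key : AffineForm r) (mask : Mask)
    (out : Fin s → AffineForm (r + r)) : AttentionLayer r s where
  width_pos := NeZero.pos r
  A := .ofForms fun k => if k = 0 then const 1 else if k = 1 then query else 0
  B := .ofForms fun k => if k = 0 then base else if k = 1 then key else 0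
  C := .ofForms out
  mask := mask
  tie := .rightmost

variable {base query key : AffineForm r} {mask : Mask} {out : Fin s → AffineForm (r + r)}
  {v : Fin n → Fin r → ℚ} {i j : Fin n}

theorem score_ofForms :
    (ofForms base query key mask out).score v i j = base (v j) + query (v i) * key (v j) := by
  have h01 : (0 : Fin r) ≠ 1 := by
    have := Nat.AtLeastTwo.one_lt (n := r)
    simp [Fin.ext_iff, Nat.mod_eq_of_lt this]
  simp only [score, ofForms, RatAffine.ofForms_apply, dotProduct]
  rw [Fintype.sum_eq_add 0 1 h01 fun k hk => by simp [hk.1, hk.2]]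
  simp [h01.symm]

theorem eval_ofForms : (ofForms base query key mask out).eval v i
    = fun k => out k (Fin.append (v i) ((ofForms base query key mask out).attentionVector v i)) :=
  RatAffine.ofForms_apply _ _

end AttentionLayer

namespace LayerSeq

/-- Composition of layer sequences; the layers of the first sequence are applied first. -/
def append : {r s t : ℕ} → LayerSeq r s → LayerSeq s t → LayerSeq r t
  | _, _, _, .nil _, M => M
  | _, _, _, .attention ℓ L, M => .attention ℓ (L.append M)
  | _, _, _, .relu k L, M => .relu k (L.append M)

/-- `n` copies of `L`, followed by `M`. -/
def iterateAppend {r t : ℕ} (L : LayerSeq r r) (M : LayerSeq r t) : ℕ → LayerSeq r t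
  | 0 => M
  | n + 1 => L.append (L.iterateAppend M n)

theorem eval_append {n : ℕ} : ∀ {r s t : ℕ} (L : LayerSeq r s) (M : LayerSeq s t)
    (v : Fin n → Fin r → ℚ), (L.append M).eval v = M.eval (L.eval v)
  | _, _, _, .nil _, _, _ => rfl
  | _, _, _, .attention _ L, M, _ => eval_append L M _
  | _, _, _, .relu _ L, M, _ => eval_append L M _

theorem eval_iterateAppend {n r t : ℕ} (L : LayerSeq r r) (M : LayerSeq r t) :
    ∀ (m : ℕ) (v : Fin n → Fin r → ℚ), (L.iterateAppend M m).eval v = M.eval (L.eval^[m] v)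
  | 0, _ => rfl
  | m + 1, v => by rw [iterateAppend, eval_append, eval_iterateAppend, Function.iterate_succ_apply]

theorem length_code_append : ∀ {r s t : ℕ} (L : LayerSeq r s) (M : LayerSeq s t),
    (L.append M).code.length + 2 = L.code.length + M.code.length
  | _, _, _, .nil _, _ => by simp [append, code, add_comm]
  | _, _, _, .attention _ L, M => by
    have := length_code_append L M
    simp [append, code]
    omega
  | _, _, _, .relu _ L, M => by
    have := length_code_append L M
    simp [append, code]
    omega

theorem length_code_iterateAppend {r t : ℕ} (L : LayerSeq r r) (M : LayerSeq r t) (m : ℕ) :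
    (L.iterateAppend M m).code.length + 2 * m = M.code.length + L.code.length * m := by
  induction m with
  | zero => rfl
  | succ m ih =>
    have := length_code_append L (L.iterateAppend M m)
    rw [iterateAppend, mul_add, mul_add]
    omega

end LayerSeq

section Flag

open Classical in
/-- The Iverson bracket of `p`, the value of a register that stores the truth value of `p`. -/
noncomputable def flag (p : Prop) : ℚ := if p then 1 else 0

variable {p : Prop}

@[simp] theorem flag_of (h : p) : flag p = 1 := if_pos h

@[simp] theorem flag_of_not (h : ¬ p) : flag p = 0 := if_neg h

theorem flag_nonneg (p : Prop) : 0 ≤ flag p := by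
  by_cases h : p <;> simp [h]

theorem flag_le_one (p : Prop) : flag p ≤ 1 := by
  by_cases h : p <;> simp [h]

theorem flag_mul_self (p : Prop) : flag p * flag p = flag p := by
  by_cases h : p <;> simp [h]

theorem flag_add_two_mul_sq (p : Prop) (a : ℚ) :
    (flag p + 2 * a) ^ 2 = flag p + 4 * (flag p * a) + 4 * a ^ 2 := by
  linear_combination flag_mul_self p

theorem max_zero_sub_mul_one_sub_flag (p : Prop) {a b : ℚ} (ha : 0 ≤ a) (hab : a ≤ b) :
    max 0 (a - b * (1 - flag p)) = flag p * a := by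
  by_cases h : p <;> simp [h, ha, hab]

theorem max_zero_flag_sub (p : Prop) (a b : ℕ) :
    max 0 (flag p - max 0 (a - b : ℚ) - max 0 (b - a : ℚ)) = flag (p ∧ b = a) := by
  by_cases h : b = a
  · simp [h, flag_nonneg]
  · have hdist : 1 ≤ max 0 (a - b : ℚ) + max 0 (b - a : ℚ) := by
      rcases lt_or_gt_of_ne h with hlt | hlt
      · have : (b : ℚ) + 1 ≤ a := by exact_mod_cast hlt
        linarith [le_max_right 0 (a - b : ℚ), le_max_left 0 (b - a : ℚ)]
      · have : (a : ℚ) + 1 ≤ b := by exact_mod_cast hlt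
        linarith [le_max_left 0 (a - b : ℚ), le_max_right 0 (b - a : ℚ)]
    rw [flag_of_not (p := p ∧ b = a) fun hpq => h hpq.2, max_eq_left]
    linarith [flag_le_one p]

end Flag

section LevelStep

open AffineForm

variable {n : ℕ}

/-- The registers of position `i` once the level with respect to the `t` preceding tokens is known.
Register 7, the product of digit and level, makes the square of the next level affine. -/
noncomputable def levelState (x : ℕ → Fin 4) (t i : ℕ) : Fin 8 → ℚ :=
  ![level x t i, (level x t i : ℚ) ^ 2, flag (x i = 2), flag (x i = 3), 2 ^ t, flag (x i = 1),
    2 ^ t * (1 - flag (x i = 1)), flag (x i = 1) * level x t i]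

/-- The layers that pass from levels with `t` digits to levels with `t + 1` digits. All scores are
`0`, so each position attends to the one before it. -/
noncomputable def levelStep : LayerSeq 8 8 :=
  .attention (.ofForms 0 0 0 .strictFuture
    ![att 5 + (2 : ℚ) • att 0, att 5 + (4 : ℚ) • att 7 + (4 : ℚ) • att 1, own 2, own 3,
      (2 : ℚ) • own 4, own 5, (2 : ℚ) • own 6, att 5 + (2 : ℚ) • att 0 - (2 : ℚ) • own 6])
    (.relu 7 (.nil 8))

theorem attentionVector_ofForms_zero {r s : ℕ} [r.AtLeastTwo] {out : Fin s → AffineForm (r + r)}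
    (v : ℕ → Fin r → ℚ) (i : Fin n) :
    (AttentionLayer.ofForms 0 0 0 .strictFuture out).attentionVector (fun j : Fin n => v j) i
      = if (i : ℕ) = 0 then 0 else v (i - 1) := by
  split_ifs with hi
  · refine AttentionLayer.attentionVector_eq_zero (Finset.eq_empty_of_forall_notMem fun j hj => ?_)
    have : j < i := AttentionLayer.mem_unmasked.1 hj
    omega
  · refine AttentionLayer.attentionVector_eq_of_isGreatest (j := ⟨i - 1, by omega⟩) rfl ⟨?_, ?_⟩
    · have hprev : (⟨i - 1, by omega⟩ : Fin n) < i := Fin.lt_def.2 (by simp; omega)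
      exact Finset.mem_filter.2 ⟨AttentionLayer.mem_unmasked.2 hprev,
        fun k _ => by simp [AttentionLayer.score_ofForms]⟩
    · intro k hk
      have : k < i := AttentionLayer.mem_unmasked.1 (Finset.mem_filter.1 hk).1
      exact Fin.le_def.2 (by simp; omega)

theorem level_succ_succ (x : ℕ → Fin 4) (t i : ℕ) :
    (level x (t + 1) (i + 1) : ℚ) = flag (x i = 1) + 2 * level x t i := by
  by_cases h : x i = 1 <;> simp [level, h]

theorem eval_levelStep (x : ℕ → Fin 4) (t : ℕ) :
    levelStep.eval (fun i : Fin n => levelState x t i)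
      = fun i : Fin n => levelState x (t + 1) i := by
  funext ⟨i, hi⟩ k
  have hle : (level x (t + 1) i : ℚ) ≤ 2 * 2 ^ t := by
    exact_mod_cast pow_succ' 2 t ▸ (level_lt x (t + 1) i).le
  have hprod := max_zero_sub_mul_one_sub_flag (x i = 1) (Nat.cast_nonneg _) hle
  simp only [levelStep, LayerSeq.eval, reluLayer, AttentionLayer.eval_ofForms,
    attentionVector_ofForms_zero]
  rcases i with _ | i
  · fin_cases k <;> simp [levelState, level, pow_succ', mul_assoc, flag_le_one, -Nat.reduceAdd]
  · rw [level_succ_succ, mul_assoc] at hprod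
    fin_cases k <;> simp [levelState, level_succ_succ, flag_add_two_mul_sq, pow_succ' _ t,
      mul_assoc, hprod, -Nat.reduceAdd]

theorem iterate_eval_levelStep (x : ℕ → Fin 4) (t : ℕ) :
    levelStep.eval^[t] (fun i : Fin n => levelState x 0 i) = fun i : Fin n => levelState x t i := by
  induction t with
  | zero => rfl
  | succ t ih => rw [Function.iterate_succ_apply', ih, eval_levelStep]

end LevelStep

section FollowsTest

open AffineForm

variable {x : ℕ → Fin 4} {t δ n : ℕ} {τ : Fin 4} {P Q : ℕ → Prop} {k : Fin 8}

/-- The registers of position `i` while the conditions of `IsLayered` are tested; the last two hold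
the results of the tests. -/
noncomputable def checkState (x : ℕ → Fin 4) (t : ℕ) (P Q : ℕ → Prop) (i : ℕ) : Fin 8 → ℚ :=
  ![level x t i, (level x t i : ℚ) ^ 2, flag (x i = 2), flag (x i = 3), 2 ^ t,
    flag (level x t i = 0), flag (P i), flag (Q i)]

/-- The attention layer that finds, for a position of level `c`, the last earlier marker of level
`c` or `c - δ`, the two levels `l` at which `(2 * c - δ) * l - l ^ 2` is maximal. It keeps register
`k` of that position and both signs of the amount by which its level fails to be `c - δ`. -/
noncomputable def followsAttention (δ : ℕ) (k : Fin 8) : AttentionLayer 8 10 :=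
  .ofForms (reg 2 + reg 3 - reg 1) ((2 : ℚ) • reg 0 - const (δ : ℚ)) (reg 0) .strictFuture
    ![own 0, own 1, own 2, own 3, own 4, own 5, own 7, att k,
      own 0 - (att 0 + const (δ : ℚ)), att 0 + const (δ : ℚ) - own 0]

/-- The layers that test `Follows x t δ τ` if register `k` holds the flag of the token `τ`. -/
noncomputable def followsTest (δ : ℕ) (k : Fin 8) : LayerSeq 8 8 :=
  .attention (followsAttention δ k) (.relu 8 (.relu 9 (.attention (.ofForms 0 0 0 .none
    ![own 0, own 1, own 2, own 3, own 4, own 5, own 6, own 7 - own 8 - own 9]) (.relu 7 (.nil 8)))))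

theorem eval_followsAttention (v : Fin n → Fin 8 → ℚ) (i : Fin n) :
    (followsAttention δ k).eval v i = ![v i 0, v i 1, v i 2, v i 3, v i 4, v i 5, v i 7,
      (followsAttention δ k).attentionVector v i k,
      v i 0 - ((followsAttention δ k).attentionVector v i 0 + δ),
      (followsAttention δ k).attentionVector v i 0 + δ - v i 0] := by
  funext m
  rw [followsAttention, AttentionLayer.eval_ofForms]
  fin_cases m <;> simp [-Nat.reduceAdd]

theorem flag_mem_markers (a : Fin 4) : flag (a ∈ markers) = flag (a = 2) + flag (a = 3) := by
  fin_cases a <;> simp [markers]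

theorem score_followsAttention (i j : Fin n) :
    (followsAttention δ k).score (fun i => checkState x t P Q i) i j
      = 1 + level x t i ^ 2 - δ * level x t i - ((1 - flag (x j ∈ markers))
        + ((level x t i - level x t j : ℤ) * (level x t i - level x t j - δ : ℤ) : ℤ)) := by
  simp only [followsAttention, AttentionLayer.score_ofForms, flag_mem_markers]
  simp [checkState]
  ring

theorem mul_sub_nonneg_of_le_one (hδ : δ ≤ 1) (d : ℤ) : 0 ≤ d * (d - δ) := by
  rcases le_or_gt d 0 with hd | hd
  · exact mul_nonneg_of_nonpos_of_nonpos hd (by omega)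
  · exact mul_nonneg hd.le (by omega)

theorem score_followsAttention_le (hδ : δ ≤ 1) (i j : Fin n) :
    (followsAttention δ k).score (fun i => checkState x t P Q i) i j
      ≤ 1 + level x t i ^ 2 - δ * level x t i := by
  have hmul := mul_sub_nonneg_of_le_one hδ (level x t i - level x t j)
  rw [score_followsAttention]
  exact sub_le_self _ (add_nonneg (sub_nonneg.2 (flag_le_one _)) (by exact_mod_cast hmul))

theorem score_followsAttention_eq_iff (hδ : δ ≤ 1) (i j : Fin n) :
    (followsAttention δ k).score (fun i => checkState x t P Q i) i j
        = 1 + level x t i ^ 2 - δ * level x t i ↔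
      x j ∈ markers ∧ (level x t j = level x t i ∨ level x t j + δ = level x t i) := by
  have hmul := mul_sub_nonneg_of_le_one hδ (level x t i - level x t j)
  rw [score_followsAttention, sub_eq_self, add_eq_zero_iff_of_nonneg
    (sub_nonneg.2 (flag_le_one _)) (by exact_mod_cast hmul), Int.cast_eq_zero, mul_eq_zero]
  refine and_congr ?_ (or_congr ?_ ?_)
  · by_cases h : x j ∈ markers <;> simp [h]
  · omega
  · omega

theorem follows_iff_of_isGreatest_best (hδ : δ ≤ 1) (hτ : τ ∈ markers) {i j : Fin n}
    (hj : IsGreatest ((followsAttention δ k).best (fun i => checkState x t P Q i) i : Set (Fin n))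
      j) :
    Follows x t δ τ i ↔ x j = τ ∧ level x t j + δ = level x t i := by
  have hbest : (∃ l < i, x l ∈ markers ∧
      (level x t l = level x t i ∨ level x t l + δ = level x t i)) →
      IsGreatest {l : ℕ | l < i ∧ x l ∈ markers ∧
        (level x t l = level x t i ∨ level x t l + δ = level x t i)} j := by
    rintro ⟨l, hl, hcand⟩
    have hmem := fun j => AttentionLayer.mem_best_iff_of_score_le (j := j)
      (fun l _ => score_followsAttention_le (P := P) (Q := Q) (k := k) hδ i l)
      (fun l _ => score_followsAttention_eq_iff hδ i l)
      ⟨l, AttentionLayer.mem_unmasked.2 hl, hcand⟩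
    obtain ⟨hji, hjcand⟩ := (hmem j).1 hj.1
    refine ⟨⟨AttentionLayer.mem_unmasked.1 hji, hjcand⟩, fun l' hl' => ?_⟩
    exact hj.2 ((hmem ⟨l', hl'.1.trans i.2⟩).2 ⟨AttentionLayer.mem_unmasked.2 hl'.1, hl'.2⟩)
  constructor
  · rintro ⟨l, hl, hlτ⟩
    rwa [hl.unique (hbest ⟨⟨l, hl.1.1.trans i.2⟩, hl.1⟩)] at hlτ
  · rintro ⟨hjτ, hji⟩
    have hlt : j < i := AttentionLayer.mem_unmasked.1 (Finset.mem_filter.1 hj.1).1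
    exact ⟨j, hbest ⟨j, hlt, hjτ ▸ hτ, .inr hji⟩, hjτ, hji⟩

theorem exists_attentionVector_followsAttention (hδ : δ ≤ 1) (hτ : τ ∈ markers)
    (hk : ∀ j, checkState x t P Q j k = flag (x j = τ)) (i : Fin n) :
    ∃ (p : Prop) (a : ℕ),
      (followsAttention δ k).attentionVector (fun i => checkState x t P Q i) i k = flag p ∧
      (followsAttention δ k).attentionVector (fun i => checkState x t P Q i) i 0 = a ∧
      (Follows x t δ τ i ↔ p ∧ a + δ = level x t i) := by
  rcases ((followsAttention δ k).unmasked i).eq_empty_or_nonempty with h | h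
  · refine ⟨False, 0, ?_, ?_, ?_⟩
    · simp [AttentionLayer.attentionVector_eq_zero h]
    · simp [AttentionLayer.attentionVector_eq_zero h]
    · refine iff_of_false (fun ⟨j, hj, _⟩ => ?_) fun h => h.1
      exact Finset.eq_empty_iff_forall_notMem.1 h ⟨j, hj.1.1.trans i.2⟩
        (AttentionLayer.mem_unmasked.2 hj.1.1)
  · obtain ⟨j, hj⟩ := AttentionLayer.exists_isGreatest_best
      (v := fun i => checkState x t P Q i) h
    rw [AttentionLayer.attentionVector_eq_of_isGreatest rfl hj]
    exact ⟨_, _, hk j, rfl, follows_iff_of_isGreatest_best hδ hτ hj⟩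

theorem eval_followsTest (hδ : δ ≤ 1) (hτ : τ ∈ markers)
    (hk : ∀ j, checkState x t P Q j k = flag (x j = τ)) :
    (followsTest δ k).eval (fun i : Fin n => checkState x t P Q i)
      = fun i : Fin n => checkState x t Q (Follows x t δ τ) i := by
  funext i m
  obtain ⟨p, a, hp, ha, hfollows⟩ :=
    exists_attentionVector_followsAttention (P := P) (Q := Q) hδ hτ hk i
  have hresult := max_zero_flag_sub p (level x t i) (a + δ)
  rw [← propext hfollows, Nat.cast_add] at hresult
  simp only [followsTest, LayerSeq.eval, reluLayer, AttentionLayer.eval_ofForms,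
    eval_followsAttention, hp, ha]
  fin_cases m <;> simp [checkState, hresult, -Nat.reduceAdd]

end FollowsTest

section Verdict

open AffineForm

variable {x : ℕ → Fin 4} {t n : ℕ} {P Q : ℕ → Prop}

/-- The layers that pass from levels to tests, when no test has been made yet. -/
noncomputable def startTests : LayerSeq 8 8 :=
  .attention (.ofForms 0 0 0 .none
    ![own 0, own 1, own 2, own 3, own 4, const 1 - own 0, 0, 0]) (.relu 5 (.nil 8))

/-- The layers that record how far a position is from being a marker of the top level and which of
the two conditions on markers it violates. -/
noncomputable def violations : LayerSeq 8 3 :=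
  .attention (.ofForms 0 0 0 .none
    ![own 4 - own 0 - (own 2 + own 3), own 2 + own 3 - own 5 - own 6, own 3 - own 7])
    (.relu 1 (.relu 2 (.nil 3)))

/-- The attention layer that adds to register `0` of a position the worst violation in the word; the
result is less than `1`, the output positive, only if everything is in order. -/
noncomputable def verdict : AttentionLayer 3 1 :=
  .ofForms (reg 1 + reg 2) 0 0 .none ![const 1 - own 0 - att 1 - att 2]

theorem eval_startTests :
    startTests.eval (fun i : Fin n => levelState x t i)
      = fun i : Fin n => checkState x t (fun _ => False) (fun _ => False) i := by
  funext i k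
  have hzero : max 0 (1 - (level x t i : ℚ)) = flag (level x t i = 0) := by
    by_cases h : level x t i = 0
    · simp [h]
    · have : (1 : ℚ) ≤ level x t i := by exact_mod_cast Nat.one_le_iff_ne_zero.2 h
      simp [h, this]
  simp only [startTests, LayerSeq.eval, reluLayer, AttentionLayer.eval_ofForms]
  fin_cases k <;> simp [levelState, checkState, hzero, -Nat.reduceAdd]

theorem eval_violations :
    violations.eval (fun i : Fin n => checkState x t P Q i)
      = fun i : Fin n => ![2 ^ t - level x t i - flag (x i ∈ markers),
          flag (x i ∈ markers ∧ level x t i ≠ 0 ∧ ¬ P i), flag (x i = 3 ∧ ¬ Q i)] := by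
  funext i k
  have hthree : max 0 (flag (x i = 3) - flag (Q i)) = flag (x i = 3 ∧ ¬ Q i) := by
    by_cases h : x i = 3 <;> by_cases hQ : Q i <;> simp [h, hQ]
  have hmarker : max 0 (flag (x i ∈ markers) - flag (level x t i = 0) - flag (P i))
      = flag (x i ∈ markers ∧ level x t i ≠ 0 ∧ ¬ P i) := by
    by_cases h : x i ∈ markers <;> by_cases hl : level x t i = 0 <;> by_cases hP : P i <;>
      simp [h, hl, hP]
  rw [flag_mem_markers] at hmarker
  simp only [violations, LayerSeq.eval, reluLayer, AttentionLayer.eval_ofForms]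
  fin_cases k <;> simp [checkState, hthree, hmarker, flag_mem_markers, -Nat.reduceAdd]

theorem verdict_eval_pos_iff (v : Fin n → Fin 3 → ℚ) (i : Fin n) :
    0 < verdict.eval v i 0 ↔ ∀ j, v i 0 + (v j 1 + v j 2) < 1 := by
  obtain ⟨j, hj, hij⟩ := AttentionLayer.exists_attentionVector_eq (ℓ := verdict) (v := v) (i := i)
    ⟨i, AttentionLayer.mem_unmasked.2 trivial⟩
  have hmax (l : Fin n) : v l 1 + v l 2 ≤ v j 1 + v j 2 := by
    simpa [verdict, AttentionLayer.score_ofForms]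
      using (Finset.mem_filter.1 hj).2 l (AttentionLayer.mem_unmasked.2 trivial)
  have heval : verdict.eval v i 0 = 1 - v i 0 - v j 1 - v j 2 := by
    rw [← hij, verdict, AttentionLayer.eval_ofForms]
    simp [-Nat.reduceAdd]
  rw [heval]
  exact ⟨fun h l => by linarith [hmax l], fun h => by linarith [h j]⟩

theorem sub_flag_add_flag_lt_one_iff {a b : ℕ} (hab : a < b) (p q r : Prop) :
    (b - a - flag p + (flag q + flag r) : ℚ) < 1 ↔ (p ∧ a + 1 = b) ∧ ¬ q ∧ ¬ r := by
  obtain ⟨c, rfl⟩ := Nat.exists_eq_add_of_lt hab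
  have hc : (a + c + 1 : ℕ) - (a : ℚ) = c + 1 := by push_cast; ring
  rw [hc]
  by_cases hp : p <;> by_cases hq : q <;> by_cases hr : r <;> simp [hp, hq, hr] <;>
    linarith [c.cast_nonneg (α := ℚ)]

/-- The layers that test `IsLayered` once the levels are known. -/
noncomputable def layeredTest : LayerSeq 8 1 :=
  startTests.append ((followsTest 1 3).append ((followsTest 0 2).append
    (violations.append (.attention verdict (.nil 1)))))

theorem isLayered_iff_of_last {i : ℕ} (hi : i + 1 = n) :
    IsLayered x t n ↔ ∀ j < n, (x i ∈ markers ∧ level x t i + 1 = 2 ^ t) ∧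
      ¬ (x j ∈ markers ∧ level x t j ≠ 0 ∧ ¬ Follows x t 1 3 j) ∧
      ¬ (x j = 3 ∧ ¬ Follows x t 0 2 j) := by
  constructor
  · rintro ⟨hthree, htwo, l, hl, hlast⟩ j hj
    obtain rfl : l = i := by omega
    exact ⟨hlast, fun h => h.2.2 (hthree j hj h.1 h.2.1), fun h => h.2 (htwo j hj h.1)⟩
  · refine fun h => ⟨fun j hj hm hl => ?_, fun j hj hm => ?_, i, hi, (h i (by omega)).1⟩
    · exact by_contra fun hF => (h j hj).2.1 ⟨hm, hl, hF⟩
    · exact by_contra fun hF => (h j hj).2.2 ⟨hm, hF⟩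

theorem layeredTest_eval_pos_iff {i : Fin n} (hi : (i : ℕ) + 1 = n) :
    0 < layeredTest.eval (fun j : Fin n => levelState x t j) i 0 ↔ IsLayered x t n := by
  rw [layeredTest, LayerSeq.eval_append, eval_startTests, LayerSeq.eval_append,
    eval_followsTest le_rfl (by simp [markers]) fun _ => rfl, LayerSeq.eval_append,
    eval_followsTest zero_le_one (by simp [markers]) fun _ => rfl, LayerSeq.eval_append,
    eval_violations, LayerSeq.eval, LayerSeq.eval, verdict_eval_pos_iff, isLayered_iff_of_last hi,
    Fin.forall_iff]
  have hlt := level_lt x t i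
  exact forall₂_congr fun j _ => by
    simpa [-not_and] using sub_flag_add_flag_lt_one_iff hlt (x i ∈ markers)
      (x j ∈ markers ∧ level x t j ≠ 0 ∧ ¬ Follows x t 1 3 j) (x j = 3 ∧ ¬ Follows x t 0 2 j)

end Verdict

section LayeredUHAT

variable {x : ℕ → Fin 4} {t : ℕ}

/-- The transformer that accepts the layered words with levels of `t` digits. -/
noncomputable def layeredUHAT (t : ℕ) : UHAT 4 where
  d := 8
  d_pos := by norm_num
  emb a := levelState (fun _ => a) 0 0
  s := 1
  layers := levelStep.iterateAppend layeredTest t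
  acceptVec := 1
  output := .last

theorem mem_layeredUHAT_lang_iff_eval {w : List (Fin 4)} :
    w ∈ (layeredUHAT t).lang ↔ ∃ hw : 0 < w.length,
      0 < (levelStep.iterateAppend layeredTest t).eval (fun i => levelState (fun _ => w.get i) 0 0)
        (OutputPosition.last.index w.length hw) 0 := by
  have hdot (v : Fin 1 → ℚ) : 0 < dotProduct 1 v ↔ 0 < v 0 := by
    rw [one_dotProduct, Fin.sum_univ_one]
  exact exists_congr fun hw => hdot _

theorem mem_layeredUHAT_lang_iff {w : List (Fin 4)} (h : ∀ i : Fin w.length, w.get i = x i) :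
    w ∈ (layeredUHAT t).lang ↔ IsLayered x t w.length := by
  have hemb : (fun i => levelState (fun _ => w.get i) 0 0)
      = fun i : Fin w.length => levelState x 0 i := by
    funext i
    simp only [levelState, level, h]
  rw [mem_layeredUHAT_lang_iff_eval, hemb, LayerSeq.eval_iterateAppend, iterate_eval_levelStep]
  have hpos (hw : 0 < w.length) :=
    layeredTest_eval_pos_iff (x := x) (t := t) (i := OutputPosition.last.index w.length hw)
      (Nat.sub_add_cancel hw)
  refine ⟨fun ⟨hw, hacc⟩ => (hpos hw).1 hacc, fun hlayered => ?_⟩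
  obtain ⟨i, hi, -⟩ := hlayered.exists_last
  exact ⟨by omega, (hpos (by omega)).2 hlayered⟩

theorem exists_mem_layeredUHAT_lang (t : ℕ) : ∃ w, w ∈ (layeredUHAT t).lang := by
  refine ⟨(List.range ((t + 1) * (3 ^ (2 ^ t - 1) + 1))).map (rulerWord t),
    (mem_layeredUHAT_lang_iff (x := rulerWord t) fun i => by simp).2 ?_⟩
  simpa using isLayered_rulerWord t

theorem two_pow_le_length_of_mem_layeredUHAT_lang {w : List (Fin 4)}
    (hw : w ∈ (layeredUHAT t).lang) : 2 ^ (2 ^ t - 1) ≤ w.length :=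
  ((mem_layeredUHAT_lang_iff (x := fun i => w.getD i 0) fun i => by simp).1 hw).two_pow_le

theorem two_lt_length_code_levelStep : 2 < levelStep.code.length := by
  simp only [levelStep, LayerSeq.code, List.length_append, List.length_cons, List.length_nil]
  omega

theorem exists_size_layeredUHAT_eq :
    ∃ a b : ℕ, 0 < b ∧ ∀ t, (layeredUHAT t).size = a + b * t := by
  refine ⟨(layeredUHAT 0).size, levelStep.code.length - 2,
    Nat.sub_pos_of_lt two_lt_length_code_levelStep, fun t => ?_⟩
  have hsize : (layeredUHAT t).size + layeredTest.code.length
      = (layeredUHAT 0).size + (levelStep.iterateAppend layeredTest t).code.length := by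
    simp only [layeredUHAT, UHAT.size, UHAT.code, List.length_append, LayerSeq.iterateAppend]
    omega
  have hcode := LayerSeq.length_code_iterateAppend levelStep layeredTest t
  have : 2 * t ≤ levelStep.code.length * t :=
    Nat.mul_le_mul_right t two_lt_length_code_levelStep.le
  rw [Nat.sub_mul]
  omega

end LayeredUHAT

theorem two_pow_two_pow_le_length_of_mem_layeredUHAT_lang (n : ℕ) {w : List (Fin 4)}
    (hw : w ∈ (layeredUHAT (n + 1)).lang) : 2 ^ 2 ^ n ≤ w.length := by
  refine le_trans (Nat.pow_le_pow_right two_pos ?_) (two_pow_le_length_of_mem_layeredUHAT_lang hw)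
  have := Nat.one_le_two_pow (n := n)
  omega

theorem tendsto_size_layeredUHAT : Tendsto (fun n => (layeredUHAT (n + 1)).size) atTop atTop := by
  obtain ⟨a, b, hb, hsize⟩ := exists_size_layeredUHAT_eq
  refine tendsto_atTop_mono (fun n => ?_) tendsto_id
  simp only [hsize, id]
  nlinarith

theorem size_layeredUHAT_isBigO :
    (fun n => ((layeredUHAT (n + 1)).size : ℝ)) =O[atTop] fun n => (n : ℝ) := by
  obtain ⟨a, b, -, hsize⟩ := exists_size_layeredUHAT_eq
  have hconst (c : ℝ) : (fun _ : ℕ => c) =O[atTop] fun n : ℕ => (n : ℝ) :=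
    (isLittleO_const_id_atTop c).natCast_atTop.isBigO
  simp only [hsize, Nat.cast_add, Nat.cast_mul, Nat.cast_one]
  exact (hconst _).add (((isBigO_refl _ _).add (hconst 1)).const_mul_left _)

theorem eventually_forcesBlowup_layeredUHAT {f : ℕ → ℝ} (hf : IsDoublyExpLittleO f) :
    ∀ᶠ n in atTop,
      ForcesBlowup (C₁ := uhatClass) finiteAutomatonClass f (layeredUHAT (n + 1)) := by
  refine eventually_forcesBlowup (C₁ := uhatClass) (T := fun n => layeredUHAT (n + 1))
    (fun A h => ?_) (fun n => exists_mem_layeredUHAT_lang _)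
    (fun n w hw => two_pow_two_pow_le_length_of_mem_layeredUHAT_lang n hw) tendsto_size_layeredUHAT
    size_layeredUHAT_isBigO hf
  obtain ⟨w, hw, hlt⟩ := FiniteAutomaton.exists_mem_lang_length_lt A h
  exact ⟨w, hw, hlt.trans A.numStates_lt_size⟩

theorem mainTheorem4 :
    CanBeDoublyExpMoreSuccinct uhatClass finiteAutomatonClass ∧
    (∃ (k : ℕ → ℕ) (T : (n : ℕ) → UHAT (k n)) (p : Polynomial ℕ),
      (∀ n, (T n).size ≤ p.eval n ∧
        (∃ w, w ∈ (T n).lang) ∧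
        ∀ w ∈ (T n).lang, 2 ^ 2 ^ n ≤ w.length) ∧
      ∀ f : ℕ → ℝ, IsDoublyExpLittleO f →
        ∃ n, ForcesBlowup (C₁ := uhatClass) finiteAutomatonClass f (T n)) ∧
    (∀ (k : ℕ) (A : FiniteAutomaton k), (∃ w, w ∈ A.lang) →
      ∃ w ∈ A.lang, w.length ≤ A.numStates) := by
  obtain ⟨a, b, -, hsize⟩ := exists_size_layeredUHAT_eq
  refine ⟨fun f hf => ?_, ⟨fun _ => 4, fun n => layeredUHAT (n + 1), .C a + .C b * (.X + 1),
    fun n => ⟨?_, ?_, ?_⟩, fun f hf => ?_⟩, fun k A h => ?_⟩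
  · obtain ⟨n, hn⟩ := (eventually_forcesBlowup_layeredUHAT hf).exists
    exact ⟨4, layeredUHAT (n + 1), hn⟩
  · simp [hsize]
  · exact exists_mem_layeredUHAT_lang (n + 1)
  · exact fun w hw => two_pow_two_pow_le_length_of_mem_layeredUHAT_lang n hw
  · exact (eventually_forcesBlowup_layeredUHAT hf).exists
  · obtain ⟨w, hw, hlt⟩ := A.exists_mem_lang_length_lt h
    exact ⟨w, hw, hlt.le⟩
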